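/- Let $\nu$ be Lebesgue measure on $\mathbb R^2$, and let $\mathcal F$ be the set of closed subsets of $\mathbb R^2$ (including $\emptyset$), with the Borel $\sigma$-algebra of the topology generated by the sets $\{F : F\cap K=\emptyset\}$ ($K$ compact) and $\{F : F\cap G\neq\emptyset\}$ ($G$ open). A random closed set is a measurable map from a probability space into $\mathcal F$. A family $\{F_i\}$ in $\mathcal F$ is a tessellation if (i) $\bigcup_i F_i=\mathbb R^2$, (ii) the interiors of $F_i$ and $F_j$ are disjoint for all $i\ne j$, and (iii) every bounded set meets only finitely many of the $F_i$. A random tessellation is a measurable map from a probability space into $\mathcal F^{\mathbb N}$ (with the product $\sigma$-algebra) which is almost surely a tessellation; members of a tessellation may be empty. Write $A\oplus B=\{a+b : a\in A,\ b\in B\}$ and $A\ominus B=\{x : x-b\in A \text{ for all } b\in B\}$. Let $X$ be a random closed set of $\mathbb R^2$ such that (C-1) $E\,\nu(X\oplus K)<\infty$ for every compact $K\subset\mathbb R^2$; (C-2) $E\,\nu(X\ominus D)>0$ for some disk $D$ of strictly positive radius. Let $\{(x_i,t_i)\}_{i\in\mathbb N}$ be a measurable enumeration of a homogeneous Poisson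 point process on $\mathbb R^2\times\mathbb R$ with intensity one, and let $(X_i)_{i\in\mathbb N}$ be i.i.d. random closed sets with the distribution of $X$, independent of the sequence $((x_i,t_i))_{i\in\mathbb N}$. For each $i$ with $t_i<0$ let $$V_i=(x_i+X_i)\setminus\bigcup_{j:\ t_j\in(t_i,0)}\bigl(x_j+\mathring X_j\bigr)$$ be the visible part of the $i$-th leaf, where $\mathring X_j$ is the interior of $X_j$, and put $V_i=\emptyset$ if $t_i\ge 0$. Then $M=\{V_i\}_{i\in\mathbb N}$ is a random tessellation of $\mathbb R^2$: it is a measurable map into $\mathcal F^{\mathbb N}$, and it is almost surely a tessellation. -/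

import Mathlib

open MeasureTheory ProbabilityTheory TopologicalSpace Set
open scoped Pointwise ENNReal

/-- The Euclidean plane; its `volume` is the Lebesgue measure `ν`. -/
abbrev Plane : Type := EuclideanSpace ℝ (Fin 2)

section RandomClosedSets

variable {S : Type*} [TopologicalSpace S]

/-- The Fell (hit-or-miss) topology on closed sets, generated by the sets
`{F | F ∩ K = ∅}`, `K` compact, and `{F | F ∩ G ≠ ∅}`, `G` open. -/
abbrev fellTopology (S : Type*) [TopologicalSpace S] : TopologicalSpace (Closeds S) :=
  TopologicalSpace.generateFrom
    ({U | ∃ K : Set S, IsCompact K ∧ U = {F : Closeds S | (F : Set S) ∩ K = ∅}} ∪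
      {U | ∃ G : Set S, IsOpen G ∧ U = {F : Closeds S | ((F : Set S) ∩ G).Nonempty}})

/-- Closed sets carry the Borel sigma-algebra of the Fell topology (and not that of the topology
of the Hausdorff distance). -/
instance instMeasurableSpaceCloseds : MeasurableSpace (Closeds S) :=
  @borel (Closeds S) (fellTopology S)

/-- A random closed set: a measurable map into the closed sets with the Fell sigma-algebra. -/
def IsRandomClosedSet {Ω : Type*} [MeasurableSpace Ω] (X : Ω → Closeds S) : Prop :=
  Measurable X

end RandomClosedSets

/-- A tessellation of the plane: a family of closed sets that covers the plane, has pairwise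
disjoint interiors, and of which only finitely many members meet any given bounded set. -/
structure IsTessellation {ι : Type*} (F : ι → Closeds Plane) : Prop where
  iUnion_eq : ⋃ i, (F i : Set Plane) = univ
  disjoint_interior : ∀ i j, i ≠ j →
    interior (F i : Set Plane) ∩ interior (F j : Set Plane) = ∅
  finite_hits : ∀ A : Set Plane, Bornology.IsBounded A →
    {i | ((F i : Set Plane) ∩ A).Nonempty}.Finite

/-- A random tessellation: a measurable map into the sequences of closed sets (product
sigma-algebra) that is almost surely a tessellation. -/
structure IsRandomTessellation {Ω : Type*} [MeasurableSpace Ω] (P : Measure Ω)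
    (T : Ω → ℕ → Closeds Plane) : Prop where
  measurable : Measurable T
  ae_isTessellation : ∀ᵐ ω ∂P, IsTessellation (T ω)

/-- The number of indices `i` with `p i ω ∈ B`. -/
noncomputable def pointCount {Ω S : Type*} (p : ℕ → Ω → S) (B : Set S) (ω : Ω) : ℕ∞ :=
  {i | p i ω ∈ B}.encard

/-- The sequence of random points `(p i)` enumerates a Poisson point process with intensity
measure `Λ`. -/
structure IsPoissonPointProcess {Ω S : Type*} [MeasurableSpace Ω] [MeasurableSpace S]
    (p : ℕ → Ω → S) (Λ : Measure S) (P : Measure Ω) : Prop where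
  measurable : ∀ i, Measurable (p i)
  map_pointCount : ∀ B : Set S, MeasurableSet B → Λ B ≠ ∞ →
    P.map (pointCount p B) = (poissonMeasure (Λ B).toNNReal).map (fun n : ℕ => (n : ℕ∞))
  iIndepFun_pointCount : ∀ (n : ℕ) (B : Fin n → Set S), (∀ k, MeasurableSet (B k)) →
    Pairwise (fun k l => Disjoint (B k) (B l)) →
    iIndepFun (fun k => pointCount p (B k)) P

/-- `A ⊖ B = {x | x + (-B) ⊆ A}`. -/
def erosion (A B : Set Plane) : Set Plane := {x | x +ᵥ (-B) ⊆ A}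

/-- The `i`-th visible part at time `0`, as a set: the leaf `x i + X i` minus the interiors of all
leaves that fall later, at times in `(t i, 0)`. -/
def visibleSet (x : ℕ → Plane) (t : ℕ → ℝ) (X : ℕ → Closeds Plane) (i : ℕ) : Set Plane :=
  (x i +ᵥ (X i : Set Plane)) \
    ⋃ j ∈ {j | t j ∈ Ioo (t i) 0}, (x j +ᵥ interior (X j : Set Plane))

theorem isClosed_visibleSet (x : ℕ → Plane) (t : ℕ → ℝ) (X : ℕ → Closeds Plane) (i : ℕ) :
    IsClosed (visibleSet x t X i) := by
  refine IsClosed.sdiff ((X i).isClosed.vadd (x i)) ?_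
  exact isOpen_biUnion fun j _ => isOpen_interior.vadd (x j)

open Classical in
/-- The visible parts of the leaves that have fallen before time `0`, as a sequence of closed
sets; the indices of the leaves with `t i ≥ 0`, which are not part of the model, get the empty
set. -/
noncomputable def visiblePart (x : ℕ → Plane) (t : ℕ → ℝ) (X : ℕ → Closeds Plane) (i : ℕ) :
    Closeds Plane :=
  if t i < 0 then ⟨visibleSet x t X i, isClosed_visibleSet x t X i⟩ else ⊥

/-!
The visible parts form a tessellation for purely deterministic reasons
(`isTessellation_visiblePart`) as soon as three events occur: the falling times are distinct, only
finitely many of the leaves fallen in `[-n, 0)` hit the ball of radius `n`, and every point of a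
countable dense set is the centre of a disk of fixed radius inside one leaf. Then a point belongs
to the visible part of the last leaf that contains it, an earlier visible part avoids the interior
of a later leaf, and a bounded set is covered by the interiors of finitely many leaves, behind which
nothing is visible.

Each event is almost sure. Two equal times have probability zero because a strip of intensity `ε`
contains two points with probability at most `ε ^ 2`
(`IsPoissonPointProcess.ae_injective_snd`). The expected number of leaves that hit a ball in a
bounded time interval is, by Campbell's formula, a multiple of the expected volume of a dilation of
the grain, finite by the condition on dilations (`IsPoissonPointProcess.ae_finite_marked`). By the
condition on erosions, the probability that a leaf at position `a` contains a given disk is at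
least some `δ > 0` for `a` in a set of positive measure; infinitely many leaves have fallen there,
and, given the positions, their grains are independent
(`IsPoissonPointProcess.ae_exists_marked`).

Measurability of the visible parts rests on the fact that the Fell topology is second countable, so
that only the events of missing a compact set matter (`measurable_closeds_of_miss`). By compactness
such an event is a countable combination of events about single leaves
(`visibleSet_inter_eq_empty_iff`).
-/

/-! ### The Fell sigma-algebra -/

section Fell

variable {S : Type*} [TopologicalSpace S]

theorem isOpen_fellTopology_miss {K : Set S} (hK : IsCompact K) :
    @IsOpen _ (fellTopology S) {F : Closeds S | (F : Set S) ∩ K = ∅} :=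
  isOpen_generateFrom_of_mem (Or.inl ⟨K, hK, rfl⟩)

theorem isOpen_fellTopology_hit {G : Set S} (hG : IsOpen G) :
    @IsOpen _ (fellTopology S) {F : Closeds S | ((F : Set S) ∩ G).Nonempty} :=
  isOpen_generateFrom_of_mem (Or.inr ⟨G, hG, rfl⟩)

theorem measurableSet_closeds_hit {G : Set S} (hG : IsOpen G) :
    MeasurableSet {F : Closeds S | ((F : Set S) ∩ G).Nonempty} :=
  MeasurableSpace.measurableSet_generateFrom (isOpen_fellTopology_hit hG)

variable [SecondCountableTopology S] [LocallyCompactSpace S] [T2Space S]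

theorem exists_mem_countableBasis_compact_closure_subset {U : Set S} (hU : IsOpen U) {a : S}
    (ha : a ∈ U) :
    ∃ B ∈ countableBasis S, a ∈ B ∧ IsCompact (closure B) ∧ closure B ⊆ U := by
  obtain ⟨K, hK, haK, hKU⟩ := exists_compact_subset hU ha
  obtain ⟨B, hB, haB, hBK⟩ := (isBasis_countableBasis S).exists_subset_of_mem_open haK
    isOpen_interior
  have h : closure B ⊆ K := hK.isClosed.closure_subset_iff.2 (hBK.trans interior_subset)
  exact ⟨B, hB, haB, hK.of_isClosed_subset isClosed_closure h, h.trans hKU⟩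

/-- The Fell topology on a locally compact second countable Hausdorff space is generated by
countably many sets: it suffices to miss the finite unions of compact closures of basic open sets,
and to hit the basic open sets. -/
theorem fellTopology_eq_generateFrom_countable :
    fellTopology S = generateFrom
      (((fun s : Set (Set S) => {F : Closeds S | (F : Set S) ∩ (⋃ B ∈ s, closure B) = ∅}) ''
        {s | s.Finite ∧ s ⊆ {B | B ∈ countableBasis S ∧ IsCompact (closure B)}}) ∪
      ((fun G : Set S => {F : Closeds S | ((F : Set S) ∩ G).Nonempty}) '' countableBasis S)) := by
  refine le_antisymm (le_generateFrom ?_) (le_generateFrom ?_)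
  · rintro _ (⟨s, ⟨hs, hsB⟩, rfl⟩ | ⟨G, hG, rfl⟩)
    · exact isOpen_fellTopology_miss (hs.isCompact_biUnion fun B hB => (hsB hB).2)
    · exact isOpen_fellTopology_hit (isOpen_of_mem_countableBasis hG)
  · rintro _ (⟨K, hK, rfl⟩ | ⟨G, hG, rfl⟩)
    · rw [@isOpen_iff_forall_mem_open]
      intro F hF
      have hKF : K ⊆ (F : Set S)ᶜ := by
        rw [mem_ofPred_eq, ← disjoint_iff_inter_eq_empty] at hF
        exact hF.symm.subset_compl_right
      choose! B hB using fun a (ha : a ∈ K) =>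
        exists_mem_countableBasis_compact_closure_subset F.isClosed.isOpen_compl (hKF ha)
      obtain ⟨u, huK, hu⟩ := hK.elim_nhds_subcover B fun a ha =>
        (isOpen_of_mem_countableBasis (hB a ha).1).mem_nhds (hB a ha).2.1
      refine ⟨_, ?_, isOpen_generateFrom_of_mem (Or.inl ⟨B '' (u : Set S), ⟨u.finite_toSet.image B,
        ?_⟩, rfl⟩), ?_⟩
      · intro F' hF'
        simp only [mem_ofPred_eq, eq_empty_iff_forall_notMem] at hF' ⊢
        rintro a ⟨haF, haK⟩
        refine hF' a ⟨haF, ?_⟩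
        obtain ⟨i, hi, hai⟩ := mem_iUnion₂.1 (hu haK)
        exact mem_biUnion (mem_image_of_mem B hi) (subset_closure hai)
      · rintro _ ⟨a, ha, rfl⟩
        exact ⟨(hB a (huK a ha)).1, (hB a (huK a ha)).2.2.1⟩
      · simp only [mem_ofPred_eq, eq_empty_iff_forall_notMem]
        rintro a ⟨haF, haU⟩
        obtain ⟨_, ⟨i, hi, rfl⟩, hai⟩ := mem_iUnion₂.1 haU
        exact (hB i (huK i hi)).2.2.2 hai haF
    · rw [@isOpen_iff_forall_mem_open]
      rintro F ⟨a, haF, haG⟩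
      obtain ⟨B, hB, haB, hBG⟩ := (isBasis_countableBasis S).exists_subset_of_mem_open haG hG
      exact ⟨_, fun F' hF' => hF'.mono (inter_subset_inter_right _ hBG),
        isOpen_generateFrom_of_mem (Or.inr ⟨B, hB, rfl⟩), ⟨a, haF, haB⟩⟩

theorem secondCountableTopology_fellTopology :
    @SecondCountableTopology (Closeds S) (fellTopology S) := by
  refine @SecondCountableTopology.mk _ (fellTopology S)
    ⟨_, Countable.union (Countable.image ?_ _) ((countable_countableBasis S).image _),
      fellTopology_eq_generateFrom_countable⟩
  exact countable_ofPred_finite_subset ((countable_countableBasis S).mono fun B hB => hB.1)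

/-- A map into the closed sets is measurable as soon as the events that it misses a compact set
are. -/
theorem measurable_closeds_of_miss {Ω : Type*} [MeasurableSpace Ω] {X : Ω → Closeds S}
    (h : ∀ K : Set S, IsCompact K → MeasurableSet {ω | (X ω : Set S) ∩ K = ∅}) :
    Measurable X := by
  have hb : (instMeasurableSpaceCloseds : MeasurableSpace (Closeds S)) = _ :=
    @borel_eq_generateFrom_of_subbasis _ _ (fellTopology S)
      secondCountableTopology_fellTopology rfl
  rw [hb]
  refine measurable_generateFrom ?_
  rintro _ (⟨K, hK, rfl⟩ | ⟨G, hG, rfl⟩)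
  · exact h K hK
  · have hEq : X ⁻¹' {F : Closeds S | ((F : Set S) ∩ G).Nonempty} =
        ⋃ B ∈ {B | B ∈ countableBasis S ∧ IsCompact (closure B) ∧ closure B ⊆ G},
          {ω | (X ω : Set S) ∩ closure B = ∅}ᶜ := by
      ext ω
      simp only [mem_preimage, mem_ofPred_eq, mem_iUnion, mem_compl_iff, exists_prop,
        ← nonempty_iff_ne_empty, ← ne_eq]
      constructor
      · rintro ⟨a, haX, haG⟩
        obtain ⟨B, hB, haB, hBc, hBG⟩ := exists_mem_countableBasis_compact_closure_subset hG haG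
        exact ⟨B, ⟨hB, hBc, hBG⟩, a, haX, subset_closure haB⟩
      · rintro ⟨B, ⟨-, -, hBG⟩, hne⟩
        exact hne.mono (inter_subset_inter_right _ hBG)
    rw [hEq]
    exact MeasurableSet.biUnion ((countable_countableBasis S).mono fun B hB => hB.1)
      fun B hB => (h _ hB.2.1).compl

end Fell

/-! ### Measurability of events about translates of closed sets -/

section Translates

variable {E : Type*} [NormedAddCommGroup E] [SecondCountableTopology E] [MeasurableSpace E]
  [BorelSpace E]

/-- The event that a translate of a closed set hits a fixed open set is jointly measurable in the
translation vector and the closed set. -/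
theorem measurableSet_vadd_hit {G : Set E} (hG : IsOpen G) :
    MeasurableSet {q : E × Closeds E | ((q.1 +ᵥ (q.2 : Set E)) ∩ G).Nonempty} := by
  have hEq : {q : E × Closeds E | ((q.1 +ᵥ (q.2 : Set E)) ∩ G).Nonempty} =
      ⋃ B ∈ {B : Set E × Set E | B ∈ countableBasis E ×ˢ countableBasis E ∧ B.1 + B.2 ⊆ G},
        B.1 ×ˢ {F : Closeds E | ((F : Set E) ∩ B.2).Nonempty} := by
    ext ⟨a, F⟩
    simp only [mem_ofPred_eq, mem_iUnion, mem_prod, exists_prop]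
    constructor
    · rintro ⟨_, ⟨f, hf, rfl⟩, hfG⟩
      have hopen : IsOpen ((fun p : E × E => p.1 + p.2) ⁻¹' G) := hG.preimage continuous_add
      obtain ⟨U, V, hU, hV, haU, hfV, hUV⟩ := isOpen_prod_iff.1 hopen a f hfG
      obtain ⟨B, hB, haB, hBU⟩ := (isBasis_countableBasis E).exists_subset_of_mem_open haU hU
      obtain ⟨C, hC, hfC, hCV⟩ := (isBasis_countableBasis E).exists_subset_of_mem_open hfV hV
      refine ⟨(B, C), ⟨⟨hB, hC⟩, ?_⟩, haB, f, hf, hfC⟩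
      rintro _ ⟨b, hb, c, hc, rfl⟩
      exact hUV (mk_mem_prod (hBU hb) (hCV hc))
    · rintro ⟨⟨B, C⟩, ⟨-, hBC⟩, haB, f, hf, hfC⟩
      exact ⟨a + f, ⟨f, hf, rfl⟩, hBC (add_mem_add haB hfC)⟩
  rw [hEq]
  refine MeasurableSet.biUnion (((countable_countableBasis E).prod
    (countable_countableBasis E)).mono fun B hB => hB.1) fun B hB => ?_
  exact (isOpen_of_mem_countableBasis hB.1.1).measurableSet.prod
    (measurableSet_closeds_hit (isOpen_of_mem_countableBasis hB.1.2))

/-- The compact counterpart of `measurableSet_vadd_hit`. -/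
theorem measurableSet_vadd_miss {K : Set E} (hK : IsCompact K) :
    MeasurableSet {q : E × Closeds E | (q.1 +ᵥ (q.2 : Set E)) ∩ K = ∅} := by
  have hEq : {q : E × Closeds E | (q.1 +ᵥ (q.2 : Set E)) ∩ K = ∅} =
      ⋃ n : ℕ, {q : E × Closeds E |
        ((q.1 +ᵥ (q.2 : Set E)) ∩ Metric.thickening (1 / ((n : ℝ) + 1)) K).Nonempty}ᶜ := by
    ext ⟨a, F⟩
    simp only [mem_ofPred_eq, mem_iUnion, mem_compl_iff, not_nonempty_iff_eq_empty,
      ← disjoint_iff_inter_eq_empty]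
    constructor
    · intro h
      obtain ⟨δ, hδ, hd⟩ := h.symm.exists_thickenings hK (F.isClosed.vadd a)
      obtain ⟨n, hn⟩ := exists_nat_one_div_lt hδ
      refine ⟨n, (hd.mono (Metric.thickening_mono hn.le K) ?_).symm⟩
      exact Metric.self_subset_thickening hδ _
    · rintro ⟨n, h⟩
      exact h.mono_right (Metric.self_subset_thickening (by positivity) K)
  rw [hEq]
  exact MeasurableSet.iUnion fun n => (measurableSet_vadd_hit Metric.isOpen_thickening).compl

theorem measurableSet_mem_closeds : MeasurableSet {q : E × Closeds E | q.1 ∈ q.2} := by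
  have h := (measurableSet_vadd_miss (E := E) (isCompact_singleton (x := 0))).compl.preimage
    (f := fun q : E × Closeds E => (-q.1, q.2)) (by fun_prop)
  convert h using 1
  ext ⟨a, F⟩
  simp [mem_vadd_set_iff_neg_vadd_mem]

/-- The event that a translate of a closed set contains a fixed open set `B` is measurable: it
is enough that the points of a countable dense set that lie in `B` are in the translate. -/
theorem measurableSet_subset_vadd {B : Set E} (hB : IsOpen B) :
    MeasurableSet {q : E × Closeds E | B ⊆ q.1 +ᵥ (q.2 : Set E)} := by
  have hEq : {q : E × Closeds E | B ⊆ q.1 +ᵥ (q.2 : Set E)} =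
      ⋂ n : ℕ, {q : E × Closeds E | denseSeq E n ∈ B → denseSeq E n - q.1 ∈ q.2} := by
    ext ⟨a, F⟩
    have hF : IsClosed (a +ᵥ (F : Set E)) := F.isClosed.vadd a
    have hmem : ∀ b, b ∈ a +ᵥ (F : Set E) ↔ b - a ∈ F := fun b => by
      rw [mem_vadd_set_iff_neg_vadd_mem, vadd_eq_add, neg_add_eq_sub]; rfl
    simp only [mem_ofPred_eq, mem_iInter, ← hmem]
    refine ⟨fun h n hn => h hn, fun h => ?_⟩
    have hd : B ⊆ closure (B ∩ range (denseSeq E)) :=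
      (denseRange_denseSeq E).open_subset_closure_inter hB
    refine hd.trans (hF.closure_subset_iff.2 ?_)
    rintro _ ⟨hb, n, rfl⟩
    exact h n hb
  rw [hEq]
  refine MeasurableSet.iInter fun n => ?_
  by_cases hn : denseSeq E n ∈ B
  · simp only [hn, true_imp_iff]
    exact measurableSet_mem_closeds.preimage
      (f := fun q : E × Closeds E => (denseSeq E n - q.1, q.2)) (by fun_prop)
  · simp [hn]

end Translates

/-! ### Visible parts -/

section VisibleParts

/-- A visible part misses a compact set `K` if and only if the part of `K` inside its leaf is
covered by finitely many basic open sets, each of them inside one single later leaf. This reduces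
the event to countably many conditions on pairs (position, grain). -/
theorem visibleSet_inter_eq_empty_iff (x : ℕ → Plane) (t : ℕ → ℝ) (X : ℕ → Closeds Plane) (i : ℕ)
    {K : Set Plane} (hK : IsCompact K) :
    visibleSet x t X i ∩ K = ∅ ↔
      ∃ s ∈ {s : Set (Set Plane) | s.Finite ∧ s ⊆ countableBasis Plane},
        (∀ B ∈ s, ∃ j, t j ∈ Ioo (t i) 0 ∧ B ⊆ x j +ᵥ (X j : Set Plane)) ∧
          (x i +ᵥ (X i : Set Plane)) ∩ (K \ ⋃₀ s) = ∅ := by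
  constructor
  · intro h
    have hC : IsCompact ((x i +ᵥ (X i : Set Plane)) ∩ K) :=
      hK.inter_left ((X i).isClosed.vadd (x i))
    have hcov : ∀ a ∈ (x i +ᵥ (X i : Set Plane)) ∩ K, ∃ B ∈ countableBasis Plane, a ∈ B ∧
        ∃ j, t j ∈ Ioo (t i) 0 ∧ B ⊆ x j +ᵥ (X j : Set Plane) := by
      rintro a ⟨haX, haK⟩
      have ha : a ∈ ⋃ j ∈ {j | t j ∈ Ioo (t i) 0}, (x j +ᵥ interior (X j : Set Plane)) := by
        by_contra hn
        exact (h ▸ ⟨⟨haX, hn⟩, haK⟩ : a ∈ (∅ : Set Plane))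
      obtain ⟨j, hj, haj⟩ := mem_iUnion₂.1 ha
      obtain ⟨B, hB, haB, hBj⟩ := (isBasis_countableBasis Plane).exists_subset_of_mem_open haj
        (isOpen_interior.vadd (x j))
      exact ⟨B, hB, haB, j, hj, hBj.trans (vadd_set_mono interior_subset)⟩
    choose! B hB haB j hj hBj using hcov
    obtain ⟨u, huC, hu⟩ := hC.elim_nhds_subcover B fun a ha =>
      (isOpen_of_mem_countableBasis (hB a ha)).mem_nhds (haB a ha)
    refine ⟨B '' (u : Set Plane), ⟨u.finite_toSet.image B, ?_⟩, ?_, ?_⟩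
    · rintro _ ⟨a, ha, rfl⟩
      exact hB a (huC a ha)
    · rintro _ ⟨a, ha, rfl⟩
      exact ⟨j a, hj a (huC a ha), hBj a (huC a ha)⟩
    · rw [eq_empty_iff_forall_notMem]
      rintro a ⟨haX, haK, hn⟩
      obtain ⟨b, hb, hab⟩ := mem_iUnion₂.1 (hu ⟨haX, haK⟩)
      exact hn ⟨B b, mem_image_of_mem B hb, hab⟩
  · rintro ⟨s, ⟨-, hsb⟩, hs, hK'⟩
    rw [eq_empty_iff_forall_notMem] at hK' ⊢
    rintro a ⟨⟨haX, hn⟩, haK⟩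
    refine hK' a ⟨haX, haK, ?_⟩
    rintro ⟨B, hB, haB⟩
    obtain ⟨j, hj, hBj⟩ := hs B hB
    refine hn (mem_biUnion hj ?_)
    rw [← interior_vadd]
    exact interior_maximal hBj (isOpen_of_mem_countableBasis (hsb hB)) haB

theorem measurable_visiblePart {Ω : Type*} [MeasurableSpace Ω] {x : ℕ → Ω → Plane}
    {t : ℕ → Ω → ℝ} {X : ℕ → Ω → Closeds Plane} (hx : ∀ i, Measurable (x i))
    (ht : ∀ i, Measurable (t i)) (hX : ∀ i, Measurable (X i)) :
    Measurable fun ω => visiblePart (fun i => x i ω) (fun i => t i ω) (fun i => X i ω) := by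
  refine measurable_pi_lambda _ fun i => measurable_closeds_of_miss fun K hK => ?_
  have hEq : {ω | (visiblePart (fun i => x i ω) (fun i => t i ω) (fun i => X i ω) i : Set Plane) ∩
      K = ∅} = {ω | 0 ≤ t i ω} ∪
        ⋃ s ∈ {s : Set (Set Plane) | s.Finite ∧ s ⊆ countableBasis Plane},
          (⋂ B ∈ s, ⋃ j, ({ω | t i ω < t j ω} ∩ {ω | t j ω < 0}) ∩
            {ω | B ⊆ x j ω +ᵥ (X j ω : Set Plane)}) ∩
          {ω | (x i ω +ᵥ (X i ω : Set Plane)) ∩ (K \ ⋃₀ s) = ∅} := by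
    ext ω
    by_cases h : t i ω < 0
    · have h' : ¬ 0 ≤ t i ω := not_le.2 h
      simp only [visiblePart, h, if_true, mem_union, mem_ofPred_eq, h', false_or]
      refine (visibleSet_inter_eq_empty_iff (fun i => x i ω) (fun i => t i ω) (fun i => X i ω) i
        hK).trans ?_
      simp only [mem_iUnion, mem_inter_iff, mem_iInter, mem_ofPred_eq, mem_Ioo, exists_prop]
    · simp [visiblePart, h, not_lt.1 h]
  rw [hEq]
  refine (measurableSet_le measurable_const (ht i)).union (MeasurableSet.biUnion
    (countable_ofPred_finite_subset (countable_countableBasis Plane)) fun s hs => ?_)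
  refine MeasurableSet.inter (MeasurableSet.biInter hs.1.countable fun B hB =>
    MeasurableSet.iUnion fun j => ?_) ?_
  · refine ((measurableSet_lt (ht i) (ht j)).inter
      (measurableSet_lt (ht j) measurable_const)).inter ?_
    exact (measurableSet_subset_vadd (isOpen_of_mem_countableBasis (hs.2 hB))).preimage
      ((hx j).prodMk (hX j))
  · exact (measurableSet_vadd_miss (hK.diff (isOpen_sUnion fun B hB =>
      isOpen_of_mem_countableBasis (hs.2 hB)))).preimage ((hx i).prodMk (hX i))

/-- The deterministic part of the argument. If the leaves fallen before time `0` fall at different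
times, only finitely many of those fallen since any given time hit any given ball, and each point
of a dense sequence is the centre of a ball of a fixed radius that lies in a leaf, then the visible
parts form a tessellation. Points are covered by the last leaf that contains them; bounded sets are covered
by the interiors of finitely many leaves, so that no earlier leaf is visible there. -/
theorem isTessellation_visiblePart {x : ℕ → Plane} {t : ℕ → ℝ} {X : ℕ → Closeds Plane} {r : ℝ}
    (hr : 0 < r) (ht : Function.Injective t)
    (hfin : ∀ n : ℕ, {i | t i ∈ Ico (-(n : ℝ)) 0 ∧
      ((x i +ᵥ (X i : Set Plane)) ∩ Metric.ball 0 n).Nonempty}.Finite)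
    (hcov : ∀ n, ∃ i, t i < 0 ∧ Metric.ball (denseSeq Plane n) r ⊆ x i +ᵥ (X i : Set Plane)) :
    IsTessellation (visiblePart x t X) := by
  have hpart : ∀ i, (visiblePart x t X i : Set Plane) ⊆ x i +ᵥ (X i : Set Plane) := by
    intro i a ha
    by_cases h : t i < 0
    · simp only [visiblePart, h, if_true] at ha
      exact ha.1
    · simp only [visiblePart, h, if_false, Closeds.coe_bot, mem_empty_iff_false] at ha
  have hneg : ∀ i a, a ∈ visiblePart x t X i → t i < 0 := by
    intro i a ha
    by_contra h
    simp only [visiblePart, h, if_false] at ha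
    exact ha
  have hsub : ∀ i j, t i < t j → t j < 0 →
      Disjoint (visiblePart x t X i : Set Plane) (x j +ᵥ interior (X j : Set Plane)) := by
    intro i j hij hj
    rw [disjoint_left]
    intro a ha haj
    simp only [visiblePart, hij.trans hj, if_true] at ha
    exact ha.2 (mem_biUnion (show j ∈ {j | t j ∈ Ioo (t i) 0} from ⟨hij, hj⟩) haj)
  have hlt : ∀ i j, t i < t j →
      interior (visiblePart x t X i : Set Plane) ∩ interior (visiblePart x t X j : Set Plane) =
        ∅ := by
    intro i j hij
    rw [eq_empty_iff_forall_notMem]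
    rintro a ⟨hai, haj⟩
    refine disjoint_left.1 (hsub i j hij (hneg j a (interior_subset haj))) (interior_subset hai) ?_
    rw [← interior_vadd]
    exact interior_mono (hpart j) haj
  have hball : ∀ a : Plane, ∃ n, a ∈ Metric.ball (denseSeq Plane n) r := by
    intro a
    obtain ⟨n, hn⟩ := (denseRange_denseSeq Plane).exists_dist_lt a hr
    exact ⟨n, hn⟩
  refine ⟨eq_univ_of_forall fun a => ?_, fun i j hij => ?_, fun A hA => ?_⟩
  · obtain ⟨n, hn⟩ := hball a
    obtain ⟨i₀, hi₀, hai₀⟩ := hcov n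
    obtain ⟨N, hN⟩ := exists_nat_gt (max (-t i₀) ‖a‖)
    have hfinA : {i | t i₀ ≤ t i ∧ t i < 0 ∧ a ∈ x i +ᵥ (X i : Set Plane)}.Finite := by
      refine (hfin N).subset ?_
      rintro i ⟨hi, hi0, hai⟩
      have h1 := (le_max_left _ _).trans_lt hN
      have h2 := (le_max_right _ _).trans_lt hN
      exact ⟨⟨by linarith, hi0⟩, a, hai, by simpa using h2⟩
    obtain ⟨i, ⟨hi, hi0, hai⟩, hmax⟩ := hfinA.exists_maximalFor t _
      ⟨i₀, le_rfl, hi₀, hai₀ hn⟩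
    refine mem_iUnion.2 ⟨i, ?_⟩
    simp only [visiblePart, hi0, if_true]
    refine ⟨hai, fun h => ?_⟩
    obtain ⟨j, hj, haj⟩ := mem_iUnion₂.1 h
    have := hmax (j := j) ⟨hi.trans hj.1.le, hj.2, vadd_set_mono interior_subset haj⟩ hj.1.le
    exact this.not_gt hj.1
  · rcases lt_or_gt_of_ne (ht.ne hij) with h | h
    · exact hlt i j h
    · rw [inter_comm]
      exact hlt j i h
  · obtain ⟨R, hAR⟩ := hA.subset_ball (0 : Plane)
    choose k hk hkX using hcov
    obtain ⟨u, hu⟩ := (isCompact_closedBall (0 : Plane) R).elim_finite_subcover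
      (fun n => Metric.ball (denseSeq Plane n) r) (fun n => Metric.isOpen_ball)
      fun a _ => mem_iUnion.2 (hball a)
    obtain ⟨N₁, hN₁⟩ := exists_nat_gt R
    obtain ⟨T, hT⟩ := (u.image fun n => -t (k n)).bddAbove
    obtain ⟨N₂, hN₂⟩ := exists_nat_gt T
    refine (hfin (max N₁ N₂)).subset ?_
    rintro i ⟨a, hai, haA⟩
    have hR : ((max N₁ N₂ : ℕ) : ℝ) ≥ R :=
      hN₁.le.trans (Nat.cast_le.2 (le_max_left _ _))
    refine ⟨⟨?_, hneg i a hai⟩, a, hpart i hai, Metric.ball_subset_ball hR (hAR haA)⟩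
    by_contra! hlt'
    obtain ⟨n, hn, han⟩ := mem_iUnion₂.1 (hu (Metric.ball_subset_closedBall (hAR haA)))
    have h1 : -t (k n) ≤ T := hT (by simpa using ⟨n, hn, rfl⟩)
    have h2 : (N₂ : ℝ) ≤ ((max N₁ N₂ : ℕ) : ℝ) := Nat.cast_le.2 (le_max_right _ _)
    refine disjoint_left.1 (hsub i (k n) (by linarith) (hk n)) hai ?_
    rw [← interior_vadd]
    exact interior_maximal (hkX n) Metric.isOpen_ball han

end VisibleParts

/-! ### Poisson distributions -/

section PoissonLaw

open scoped NNReal Nat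

theorem lintegral_natCast_poissonMeasure (r : ℝ≥0) :
    ∫⁻ n, (n : ℝ≥0∞) ∂(poissonMeasure r) = r := by
  have h : HasSum (fun n : ℕ => Real.exp (-r) * (r : ℝ) ^ n / (n)! * n) r := by
    rw [← hasSum_nat_add_iff' 1]
    have h1 := (hasSum_one_poissonMeasure r).mul_left (r : ℝ)
    have hfun : (fun n : ℕ => Real.exp (-r) * (r : ℝ) ^ (n + 1) / (n + 1)! * (n + 1 : ℕ)) =
        fun n : ℕ => (r : ℝ) * (Real.exp (-r) * (r : ℝ) ^ n / (n)!) := by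
      funext n
      rw [Nat.factorial_succ]
      push_cast
      field_simp
      ring
    rw [hfun]
    simpa using h1
  rw [poissonMeasure, lintegral_sum_measure]
  simp only [lintegral_smul_measure, lintegral_dirac, smul_eq_mul]
  have hsum := ENNReal.ofReal_tsum_of_nonneg (fun n => by positivity) h.summable
  rw [h.tsum_eq, ENNReal.ofReal_coe_nnreal] at hsum
  rw [hsum]
  refine tsum_congr fun n => ?_
  rw [ENNReal.ofReal_mul (by positivity), ENNReal.ofReal_natCast]

theorem poissonMeasure_two_le (r : ℝ≥0) :
    poissonMeasure r {n | 2 ≤ n} ≤ (r : ℝ≥0∞) ^ 2 := by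
  have hset : {n : ℕ | 2 ≤ n} = (({0, 1} : Finset ℕ) : Set ℕ)ᶜ := by
    ext n
    simp only [mem_ofPred_eq, Finset.coe_insert, Finset.coe_singleton, mem_compl_iff,
      mem_insert_iff, mem_singleton_iff]
    omega
  have hreal : (poissonMeasure r).real {n | 2 ≤ n} ≤ (r : ℝ) ^ 2 := by
    rw [hset, measureReal_compl .of_discrete, ← sum_measureReal_singleton]
    simp only [poissonMeasure_real_singleton, probReal_univ]
    have h1 := Real.add_one_le_exp (-(r : ℝ))
    have h2 : (0 : ℝ) ≤ r := r.coe_nonneg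
    norm_num
    nlinarith
  rw [← ENNReal.ofReal_coe_nnreal, ← ENNReal.ofReal_pow r.coe_nonneg]
  exact (ENNReal.le_ofReal_iff_toReal_le (measure_ne_top _ _) (by positivity)).2 hreal

theorem tendsto_poissonMeasure_le {a : ℕ → ℝ≥0} (ha : Filter.Tendsto a Filter.atTop Filter.atTop)
    (k : ℕ) :
    Filter.Tendsto (fun n => poissonMeasure (a n) {j | j ≤ k}) Filter.atTop (nhds 0) := by
  have hset : {j : ℕ | j ≤ k} = (Finset.range (k + 1) : Set ℕ) := by
    ext n
    simp
  have hsum : ∀ n, poissonMeasure (a n) {j | j ≤ k} =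
      ∑ j ∈ Finset.range (k + 1), ENNReal.ofReal (Real.exp (-a n) * (a n : ℝ) ^ j / (j)!) := by
    intro n
    rw [hset, ← sum_measure_singleton]
    simp only [poissonMeasure_singleton]
  simp only [hsum]
  rw [← Finset.sum_const_zero (s := Finset.range (k + 1))]
  refine tendsto_finsetSum _ fun j _ => ?_
  rw [← ENNReal.ofReal_zero]
  refine ENNReal.tendsto_ofReal ?_
  have h := ((Real.tendsto_pow_mul_exp_neg_atTop_nhds_zero j).comp
    (NNReal.tendsto_coe_atTop.2 ha)).div_const ((j)! : ℝ)
  simpa [Function.comp_def, mul_comm] using h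

end PoissonLaw

/-! ### Counts of a Poisson process -/

section PointProcess

variable {Ω S : Type*} [MeasurableSpace Ω] [MeasurableSpace S] {p : ℕ → Ω → S} {Λ : Measure S}
  {P : Measure Ω}

namespace IsPoissonPointProcess

/-- Measurability of the counts is implicit in the law prescribed for them, since the image
measure under a map that is not a.e. measurable is zero. -/
theorem aemeasurable_pointCount (h : IsPoissonPointProcess p Λ P) {B : Set S}
    (hB : MeasurableSet B) (hΛ : Λ B ≠ ∞) : AEMeasurable (pointCount p B) P := by
  refine AEMeasurable.of_map_ne_zero ?_
  rw [h.map_pointCount B hB hΛ]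
  exact IsProbabilityMeasure.ne_zero _

theorem measure_pointCount_mem (h : IsPoissonPointProcess p Λ P) {B : Set S}
    (hB : MeasurableSet B) (hΛ : Λ B ≠ ∞) (s : Set ℕ∞) :
    P {ω | pointCount p B ω ∈ s} = poissonMeasure (Λ B).toNNReal {n : ℕ | (n : ℕ∞) ∈ s} := by
  have hs : MeasurableSet s := .of_discrete
  have h1 := congrArg (fun m => m s) (h.map_pointCount B hB hΛ)
  simp only [Measure.map_apply_of_aemeasurable (h.aemeasurable_pointCount hB hΛ) hs,
    Measure.map_apply (Measurable.of_discrete (f := fun n : ℕ => (n : ℕ∞))) hs] at h1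
  exact h1

theorem tsum_measure_preimage (h : IsPoissonPointProcess p Λ P) {B : Set S}
    (hB : MeasurableSet B) (hΛ : Λ B ≠ ∞) : ∑' i, P (p i ⁻¹' B) = Λ B := by
  have hcount : ∀ ω, ((pointCount p B ω : ℕ∞) : ℝ≥0∞) =
      ∑' i, (p i ⁻¹' B).indicator (fun _ => (1 : ℝ≥0∞)) ω := by
    intro ω
    rw [pointCount, ← ENNReal.tsum_set_one, tsum_subtype {i | p i ω ∈ B} fun _ => (1 : ℝ≥0∞)]
    rfl
  calc ∑' i, P (p i ⁻¹' B)
      = ∑' i, ∫⁻ ω, (p i ⁻¹' B).indicator (fun _ => (1 : ℝ≥0∞)) ω ∂P :=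
        tsum_congr fun i => by rw [lintegral_indicator_const (h.measurable i hB), one_mul]
    _ = ∫⁻ ω, ((pointCount p B ω : ℕ∞) : ℝ≥0∞) ∂P := by
        rw [← lintegral_tsum fun i =>
          (measurable_const.indicator (h.measurable i hB)).aemeasurable]
        exact lintegral_congr fun ω => (hcount ω).symm
    _ = ∫⁻ k, ((k : ℕ∞) : ℝ≥0∞) ∂(P.map (pointCount p B)) :=
        (lintegral_map' (f := fun k : ℕ∞ => (k : ℝ≥0∞)) Measurable.of_discrete.aemeasurable
          (h.aemeasurable_pointCount hB hΛ)).symm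
    _ = ∫⁻ n : ℕ, (n : ℝ≥0∞) ∂(poissonMeasure (Λ B).toNNReal) := by
        rw [h.map_pointCount B hB hΛ, lintegral_map Measurable.of_discrete .of_discrete]
        simp
    _ = Λ B := by
        rw [lintegral_natCast_poissonMeasure, ENNReal.coe_toNNReal hΛ]

/-- Campbell's formula: the intensity measure is the sum of the laws of the points. -/
theorem sum_map_eq [SigmaFinite Λ] (h : IsPoissonPointProcess p Λ P) :
    Measure.sum (fun i => P.map (p i)) = Λ := by
  rw [Measure.ext_iff_of_iUnion_eq_univ (iUnion_spanningSets Λ)]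
  intro n
  ext B hB
  have hm : MeasurableSet (B ∩ spanningSets Λ n) := hB.inter (measurableSet_spanningSets Λ n)
  have hΛ : Λ (B ∩ spanningSets Λ n) ≠ ∞ :=
    ((measure_mono inter_subset_right).trans_lt (measure_spanningSets_lt_top Λ n)).ne
  rw [Measure.restrict_apply hB, Measure.restrict_apply hB, Measure.sum_apply _ hm,
    ← h.tsum_measure_preimage hm hΛ]
  exact tsum_congr fun i => Measure.map_apply (h.measurable i) hm

/-- A set that contains sets of arbitrarily large finite intensity contains infinitely many
points. -/
theorem ae_infinite (h : IsPoissonPointProcess p Λ P) {B : ℕ → Set S} {U : Set S}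
    (hB : ∀ n, MeasurableSet (B n)) (hΛ : ∀ n, Λ (B n) ≠ ∞) (hBU : ∀ n, B n ⊆ U)
    (hlim : Filter.Tendsto (fun n => (Λ (B n)).toNNReal) Filter.atTop Filter.atTop) :
    ∀ᵐ ω ∂P, {i | p i ω ∈ U}.Infinite := by
  have hk : ∀ k : ℕ, ∀ᵐ ω ∂P, ¬ pointCount p U ω ≤ k := by
    intro k
    rw [ae_iff]
    refine le_antisymm (ge_of_tendsto' (tendsto_poissonMeasure_le hlim k) fun n => ?_) zero_le
    have hset : {j : ℕ | j ≤ k} = {j : ℕ | (j : ℕ∞) ∈ Iic (k : ℕ∞)} := by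
      ext j
      simp
    rw [hset, ← h.measure_pointCount_mem (hB n) (hΛ n)]
    refine measure_mono fun ω hω => ?_
    simp only [not_not, mem_ofPred_eq] at hω
    exact (encard_le_encard fun i (hi : p i ω ∈ B n) => hBU n hi).trans hω
  filter_upwards [ae_all_iff.2 hk] with ω hω hfin
  exact hω hfin.toFinset.card (by simp [pointCount, hfin.encard_eq_coe_toFinset_card])

/-- The second coordinates of the points of a Poisson process on a product with the real line are
distinct: two points of a unit strip over a set of measure `v` with the same second
coordinate lie in one of `m` strips of intensity `v / m`, which has probability at most
`m * (v / m) ^ 2`. -/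
theorem ae_injective_snd {α : Type*} [MeasurableSpace α] {ρ : Measure α} [SigmaFinite ρ]
    {p : ℕ → Ω → α × ℝ} (h : IsPoissonPointProcess p (ρ.prod volume) P) :
    ∀ᵐ ω ∂P, Function.Injective fun i => (p i ω).2 := by
  have hstrip : ∀ (n : ℕ) (k : ℤ), ∀ᵐ ω ∂P, ∀ i j, (p i ω).1 ∈ spanningSets ρ n →
      (p j ω).1 ∈ spanningSets ρ n → (p i ω).2 ∈ Ico (k : ℝ) (k + 1) →
      (p i ω).2 = (p j ω).2 → i = j := by
    intro n k
    rw [ae_iff]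
    have hv := (measure_spanningSets_lt_top ρ n).ne
    have hbound : ∀ m : ℕ, P {ω | ¬ ∀ i j, (p i ω).1 ∈ spanningSets ρ n →
        (p j ω).1 ∈ spanningSets ρ n → (p i ω).2 ∈ Ico (k : ℝ) (k + 1) →
        (p i ω).2 = (p j ω).2 → i = j} ≤
          ENNReal.ofReal ((ρ (spanningSets ρ n)).toReal ^ 2 * (1 / ((m : ℝ) + 1))) := by
      intro m
      have hm : (0 : ℝ) < m + 1 := by positivity
      let B : ℕ → Set (α × ℝ) := fun l =>
        spanningSets ρ n ×ˢ Ico (k + l / ((m : ℝ) + 1)) (k + (l + 1) / ((m : ℝ) + 1))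
      have hB : ∀ l, MeasurableSet (B l) := fun l =>
        (measurableSet_spanningSets ρ n).prod measurableSet_Ico
      have hΛ : ∀ l, (ρ.prod volume) (B l) =
          ENNReal.ofReal ((ρ (spanningSets ρ n)).toReal * (1 / ((m : ℝ) + 1))) := by
        intro l
        rw [Measure.prod_prod, Real.volume_Ico, ENNReal.ofReal_mul ENNReal.toReal_nonneg,
          ENNReal.ofReal_toReal hv]
        congr 2
        ring
      have hsub : {ω | ¬ ∀ i j, (p i ω).1 ∈ spanningSets ρ n →
          (p j ω).1 ∈ spanningSets ρ n → (p i ω).2 ∈ Ico (k : ℝ) (k + 1) →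
          (p i ω).2 = (p j ω).2 → i = j} ⊆
          ⋃ l ∈ Finset.range (m + 1), {ω | pointCount p (B l) ω ∈ Ici (2 : ℕ∞)} := by
        intro ω hω
        simp only [mem_ofPred_eq, not_forall] at hω
        obtain ⟨i, j, hi, hj, hk, hij, hne⟩ := hω
        have h0 : 0 ≤ ((p i ω).2 - k) * ((m : ℝ) + 1) :=
          mul_nonneg (sub_nonneg.2 hk.1) hm.le
        have hmem : (p i ω).2 ∈ Ico (k + (⌊((p i ω).2 - k) * ((m : ℝ) + 1)⌋₊ : ℝ) / ((m : ℝ) + 1))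
            (k + (⌊((p i ω).2 - k) * ((m : ℝ) + 1)⌋₊ + 1 : ℝ) / ((m : ℝ) + 1)) := by
          have h1 := (div_le_iff₀ hm).2 (Nat.floor_le h0)
          have h2 := (lt_div_iff₀ hm).2 (Nat.lt_floor_add_one (((p i ω).2 - k) * ((m : ℝ) + 1)))
          constructor <;> linarith
        refine mem_biUnion (x := ⌊((p i ω).2 - k) * ((m : ℝ) + 1)⌋₊) ?_ ?_
        · rw [Finset.mem_coe, Finset.mem_range, Nat.floor_lt h0]
          push_cast
          nlinarith [hk.2]
        · change 2 ≤ pointCount p _ ω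
          rw [pointCount, ← encard_pair hne]
          refine encard_le_encard ?_
          rintro _ (rfl | rfl)
          · exact ⟨hi, hmem⟩
          · exact ⟨hj, hij ▸ hmem⟩
      calc _ ≤ P (⋃ l ∈ Finset.range (m + 1), {ω | pointCount p (B l) ω ∈ Ici (2 : ℕ∞)}) :=
            measure_mono hsub
        _ ≤ ∑ l ∈ Finset.range (m + 1), P {ω | pointCount p (B l) ω ∈ Ici (2 : ℕ∞)} :=
            measure_biUnion_finset_le _ _
        _ ≤ ∑ l ∈ Finset.range (m + 1),
              ENNReal.ofReal ((ρ (spanningSets ρ n)).toReal * (1 / ((m : ℝ) + 1))) ^ 2 := by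
            refine Finset.sum_le_sum fun l _ => ?_
            rw [h.measure_pointCount_mem (hB l) (by rw [hΛ]; exact ENNReal.ofReal_ne_top)]
            have hset : {j : ℕ | (j : ℕ∞) ∈ Ici (2 : ℕ∞)} = {j : ℕ | 2 ≤ j} := by
              ext j
              simp only [mem_ofPred_eq, mem_Ici]
              exact_mod_cast Iff.rfl
            rw [hset]
            refine (poissonMeasure_two_le _).trans_eq ?_
            rw [ENNReal.coe_toNNReal (by rw [hΛ]; exact ENNReal.ofReal_ne_top), hΛ]
        _ = ENNReal.ofReal ((ρ (spanningSets ρ n)).toReal ^ 2 * (1 / ((m : ℝ) + 1))) := by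
            rw [Finset.sum_const, Finset.card_range, nsmul_eq_mul,
              ← ENNReal.ofReal_pow (by positivity), ← ENNReal.ofReal_natCast,
              ← ENNReal.ofReal_mul (by positivity)]
            congr 1
            push_cast
            field_simp
    have hlim : Filter.Tendsto (fun m : ℕ =>
        ENNReal.ofReal ((ρ (spanningSets ρ n)).toReal ^ 2 * (1 / ((m : ℝ) + 1)))) Filter.atTop
        (nhds 0) := by
      rw [← ENNReal.ofReal_zero]
      refine ENNReal.tendsto_ofReal ?_
      simpa using tendsto_one_div_add_atTop_nhds_zero_nat.const_mul
        ((ρ (spanningSets ρ n)).toReal ^ 2)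
    exact le_antisymm (ge_of_tendsto' hlim hbound) zero_le
  filter_upwards [ae_all_iff.2 fun n => ae_all_iff.2 (hstrip n)] with ω hω i j hij
  refine hω (max (spanningSetsIndex ρ (p i ω).1) (spanningSetsIndex ρ (p j ω).1)) ⌊(p i ω).2⌋ i j
    ?_ ?_ ⟨Int.floor_le _, Int.lt_floor_add_one _⟩ hij
  · exact monotone_spanningSets ρ (le_max_left _ _) (mem_spanningSetsIndex ρ _)
  · exact monotone_spanningSets ρ (le_max_right _ _) (mem_spanningSetsIndex ρ _)

end IsPoissonPointProcess

end PointProcess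

/-! ### Marked Poisson processes -/

section Marks

variable {Ω S M : Type*} [MeasurableSpace Ω] [MeasurableSpace S] [MeasurableSpace M]
  {P : Measure Ω} [IsProbabilityMeasure P]

/-- Campbell's formula for a Poisson process with independent marks of law `μ`: the expected
number of marked points in `C` is `(Λ.prod μ) C`. Here it yields that this number is a.s. finite
if `(Λ.prod μ) C` is. -/
theorem IsPoissonPointProcess.ae_finite_marked {p : ℕ → Ω → S} {Λ : Measure S} [SigmaFinite Λ]
    (hp : IsPoissonPointProcess p Λ P) {μ : Measure M} [SigmaFinite μ] {X : ℕ → Ω → M}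
    (hX : ∀ i, Measurable (X i)) (hXlaw : ∀ i, P.map (X i) = μ)
    (hind : ∀ i, IndepFun (p i) (X i) P) {C : Set (S × M)} (hC : MeasurableSet C)
    (hfin : (Λ.prod μ) C ≠ ∞) : ∀ᵐ ω ∂P, {i | (p i ω, X i ω) ∈ C}.Finite := by
  refine ae_finite_setOfPred_mem (s := fun i => {ω | (p i ω, X i ω) ∈ C}) ?_
  have hi : ∀ i, P {ω | (p i ω, X i ω) ∈ C} = ∫⁻ a, μ (Prod.mk a ⁻¹' C) ∂(P.map (p i)) := by
    intro i
    have hlaw := (indepFun_iff_map_prod_eq_prod_map_map (hp.measurable i).aemeasurable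
      (hX i).aemeasurable).1 (hind i)
    rw [hXlaw] at hlaw
    rw [← Measure.prod_apply hC, ← hlaw,
      Measure.map_apply ((hp.measurable i).prodMk (hX i)) hC]
    rfl
  simp only [hi]
  rwa [← lintegral_sum_measure, hp.sum_map_eq, ← Measure.prod_apply hC]

theorem ae_infinitePi_exists_mem {μ : Measure M} [IsProbabilityMeasure μ] {A : ℕ → Set M}
    (hA : ∀ i, MeasurableSet (A i)) {δ : ℝ≥0∞} (hδ : δ ≠ 0) (hinf : {i | δ ≤ μ (A i)}.Infinite) :
    ∀ᵐ F ∂(Measure.infinitePi fun _ : ℕ => μ), ∃ i, F i ∈ A i := by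
  rw [ae_iff]
  have hbound : ∀ n : ℕ,
      (Measure.infinitePi fun _ : ℕ => μ) {F | ¬ ∃ i, F i ∈ A i} ≤ (1 - δ) ^ n := by
    intro n
    obtain ⟨s, hs, hsn⟩ := hinf.exists_subset_card_eq n
    calc (Measure.infinitePi fun _ : ℕ => μ) {F | ¬ ∃ i, F i ∈ A i}
        ≤ (Measure.infinitePi fun _ : ℕ => μ) ((s : Set ℕ).pi fun i => (A i)ᶜ) := by
          refine measure_mono fun F hF i _ hi => hF ⟨i, hi⟩
      _ = ∏ i ∈ s, μ (A i)ᶜ := Measure.infinitePi_pi _ fun i _ => (hA i).compl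
      _ ≤ ∏ i ∈ s, (1 - δ) := by
          refine Finset.prod_le_prod' fun i hi => ?_
          rw [prob_compl_eq_one_sub (hA i)]
          exact tsub_le_tsub_left (hs hi) 1
      _ = (1 - δ) ^ n := by rw [Finset.prod_const, hsn]
  refine le_antisymm (ge_of_tendsto' (ENNReal.tendsto_pow_atTop_nhds_zero_of_lt_one ?_) hbound)
    zero_le
  exact ENNReal.sub_lt_self ENNReal.one_ne_top one_ne_zero hδ

/-- If marks in the sets `H a` have positive probability for a set of positions `a` of positive
measure, then in a Poisson process on `α × ℝ` with i.i.d. marks there is a.s. a point at a negative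
time whose mark lies in `H a`, where `a` is its position. Given the points, infinitely many of
which lie at positions where this probability is at least some `δ > 0`, the marks are still
independent. -/
theorem IsPoissonPointProcess.ae_exists_marked {α : Type*} [MeasurableSpace α] {ρ : Measure α}
    [SigmaFinite ρ] {p : ℕ → Ω → α × ℝ} (hp : IsPoissonPointProcess p (ρ.prod volume) P)
    {μ : Measure M} [IsProbabilityMeasure μ] {X : ℕ → Ω → M}
    (hX : ∀ i, Measurable (X i)) (hXlaw : ∀ i, P.map (X i) = μ) (hXindep : iIndepFun X P)
    (hind : IndepFun (fun ω i => p i ω) (fun ω i => X i ω) P) {H : Set (α × M)}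
    (hH : MeasurableSet H) (hpos : (ρ.prod μ) H ≠ 0) :
    ∀ᵐ ω ∂P, ∃ i, (p i ω).2 < 0 ∧ ((p i ω).1, X i ω) ∈ H := by
  obtain ⟨k, hk⟩ : ∃ k : ℕ, ρ {a | 1 / ((k : ℝ≥0∞) + 1) ≤ μ (Prod.mk a ⁻¹' H)} ≠ 0 := by
    by_contra! hk
    refine hpos ((Measure.measure_prod_null hH).2 ?_)
    have := ae_all_iff.2 fun k : ℕ =>
      (measure_eq_zero_iff_ae_notMem.1 (hk k))
    filter_upwards [this] with a ha
    by_contra h0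
    obtain ⟨n, hn⟩ := ENNReal.exists_inv_nat_lt h0
    refine ha n ?_
    rw [one_div]
    exact (ENNReal.inv_le_inv.2 le_self_add).trans hn.le
  obtain ⟨Q, hQ, hQsub, hQ0, hQtop⟩ := Measure.exists_subset_measure_lt_top
    (measurableSet_le measurable_const (measurable_measure_prodMk_left hH))
    (pos_iff_ne_zero.2 hk)
  have hinf : ∀ᵐ ω ∂P, {i | p i ω ∈ Q ×ˢ Iio (0 : ℝ)}.Infinite := by
    have hΛ : ∀ n : ℕ, (ρ.prod volume) (Q ×ˢ Ico (-(n : ℝ)) 0) = ρ Q * n := by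
      intro n
      rw [Measure.prod_prod, Real.volume_Ico]
      simp
    refine hp.ae_infinite (B := fun n : ℕ => Q ×ˢ Ico (-(n : ℝ)) 0)
      (fun n => hQ.prod measurableSet_Ico) (fun n => ?_)
      (fun n => prod_mono_right fun _ h => h.2) ?_
    · rw [hΛ]
      exact ENNReal.mul_ne_top hQtop.ne (ENNReal.natCast_ne_top n)
    · simp only [hΛ, ENNReal.toNNReal_mul, ENNReal.toNNReal_natCast]
      exact tendsto_natCast_atTop_atTop.const_mul_atTop
        (ENNReal.toNNReal_pos hQ0.ne' hQtop.ne)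
  have hpm : Measurable fun ω i => p i ω := measurable_pi_lambda _ hp.measurable
  have hXm : Measurable fun ω i => X i ω := measurable_pi_lambda _ hX
  have hlaw := (indepFun_iff_map_prod_eq_prod_map_map hpm.aemeasurable hXm.aemeasurable).1 hind
  rw [hXindep.map_fun_eq_infinitePi_map₀ hXm.aemeasurable] at hlaw
  simp only [hXlaw] at hlaw
  have hA : MeasurableSet {q : (ℕ → α × ℝ) × (ℕ → M) |
      ∃ i, (q.1 i).2 < 0 ∧ ((q.1 i).1, q.2 i) ∈ H} := by
    rw [ofPred_exists]
    refine MeasurableSet.iUnion fun i => ?_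
    exact (measurableSet_lt (f := fun q : (ℕ → α × ℝ) × (ℕ → M) => (q.1 i).2) (by fun_prop)
      measurable_const).inter
      (hH.preimage (f := fun q : (ℕ → α × ℝ) × (ℕ → M) => ((q.1 i).1, q.2 i)) (by fun_prop))
  have hprod : ∀ᵐ q ∂(P.map fun ω i => p i ω).prod (Measure.infinitePi fun _ : ℕ => μ),
      ∃ i, (q.1 i).2 < 0 ∧ ((q.1 i).1, q.2 i) ∈ H := by
    rw [Measure.ae_prod_iff_ae_ae hA]
    refine (ae_map_iff hpm.aemeasurable
      (measurable_measure_prodMk_left hA.compl (measurableSet_singleton 0))).2 ?_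
    filter_upwards [hinf] with ω hω
    have hAi : ∀ i, MeasurableSet {F : M | (p i ω).2 < 0 ∧ ((p i ω).1, F) ∈ H} := fun i =>
      (MeasurableSet.const _).inter (measurable_prodMk_left hH)
    refine ae_infinitePi_exists_mem hAi
      (δ := 1 / ((k : ℝ≥0∞) + 1)) (by simp) (hω.mono ?_)
    rintro i ⟨hi, hneg⟩
    have hi' : 1 / ((k : ℝ≥0∞) + 1) ≤ μ (Prod.mk (p i ω).1 ⁻¹' H) := hQsub hi
    refine hi'.trans (measure_mono fun F hF => ⟨hneg, hF⟩)
  rw [← hlaw] at hprod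
  exact ae_of_ae_map (hpm.prodMk hXm).aemeasurable hprod

end Marks

/-! ### Leaves and balls -/

section Leaves

/-- A translate `x + F` hits a ball around the origin only if `-x` lies in the dilation of `F` by
the ball, so that the volume of these `x` is controlled by the condition on dilations. -/
theorem measure_vadd_hit_ball_le (F : Set Plane) (R : ℝ) :
    volume {x : Plane | ((x +ᵥ F) ∩ Metric.ball 0 R).Nonempty} ≤
      volume (F + Metric.closedBall (0 : Plane) R) := by
  rw [← Measure.measure_neg]
  refine measure_mono fun x hx => ?_
  obtain ⟨_, ⟨f, hf, rfl⟩, hfR⟩ := hx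
  refine ⟨f, hf, x - f, ?_, add_sub_cancel f x⟩
  simp only [vadd_eq_add, mem_ball_zero_iff, mem_closedBall_zero_iff] at hfR ⊢
  rw [norm_sub_rev, sub_eq_neg_add]
  exact hfR.le

/-- If `z + c - x` lies in the erosion of `F` by the disk of centre `c`, then `x + F` contains the
disk of the same radius around `z`. -/
theorem volume_erosion_le (F : Set Plane) (c z : Plane) (r : ℝ) :
    volume (erosion F (Metric.closedBall c r)) ≤
      volume {x : Plane | Metric.ball z r ⊆ x +ᵥ F} := by
  rw [← (Measure.measurePreserving_sub_left volume (z + c)).measure_preimage_emb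
    (MeasurableEquiv.subLeft (z + c)).measurableEmbedding]
  refine measure_mono fun x hx => ?_
  have hx' : (z + c - x) +ᵥ (-Metric.closedBall c r) ⊆ F := hx
  intro y hy
  refine ⟨y - x, hx' ⟨y - z - c, ?_, ?_⟩, ?_⟩
  · rw [Set.mem_neg, Metric.mem_closedBall, dist_eq_norm]
    rw [Metric.mem_ball, dist_eq_norm, ← norm_neg] at hy
    have h : -(y - z - c) - c = -(y - z) := by abel
    exact h ▸ hy.le
  · change z + c - x + (y - z - c) = y - x
    abel
  · simp

end Leaves

/-! ### The dead leaves tessellation -/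

theorem mainTheorem5
    {Ω₀ : Type*} [MeasurableSpace Ω₀] (P₀ : Measure Ω₀) [IsProbabilityMeasure P₀]
    -- the grain
    (X₀ : Ω₀ → Closeds Plane) (hX₀ : IsRandomClosedSet X₀)
    (hC1 : ∀ K : Set Plane, IsCompact K →
      ∫⁻ ω, volume ((X₀ ω : Set Plane) + K) ∂P₀ < ∞)
    (hC2 : ∃ (c : Plane) (r : ℝ), 0 < r ∧
      0 < ∫⁻ ω, volume (erosion (X₀ ω : Set Plane) (Metric.closedBall c r)) ∂P₀)
    {Ω : Type*} [MeasurableSpace Ω] (P : Measure Ω) [IsProbabilityMeasure P]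
    -- the Poisson process of positions and falling times
    (x : ℕ → Ω → Plane) (t : ℕ → Ω → ℝ)
    (hxt : IsPoissonPointProcess (fun i ω => (x i ω, t i ω))
      (volume : Measure (Plane × ℝ)) P)
    -- the i.i.d. copies of the grain, independent of the Poisson process
    (X : ℕ → Ω → Closeds Plane) (hX : ∀ i, IsRandomClosedSet (X i))
    (hXlaw : ∀ i, P.map (X i) = P₀.map X₀)
    (hXindep : iIndepFun X P)
    (hindep : IndepFun (fun ω i => (x i ω, t i ω)) (fun ω i => X i ω) P) :
    IsRandomTessellation P
      (fun ω => visiblePart (fun i => x i ω) (fun i => t i ω) (fun i => X i ω)) := by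
  have hxm : ∀ i, Measurable (x i) := fun i => (hxt.measurable i).fst
  have htm : ∀ i, Measurable (t i) := fun i => (hxt.measurable i).snd
  refine ⟨measurable_visiblePart hxm htm hX, ?_⟩
  obtain ⟨c, r, hr, hC2⟩ := hC2
  have hX₀m : Measurable X₀ := hX₀
  have : IsProbabilityMeasure (P₀.map X₀) := Measure.isProbabilityMeasure_map hX₀m.aemeasurable
  have hinj := IsPoissonPointProcess.ae_injective_snd (ρ := (volume : Measure Plane)) hxt
  have hfin : ∀ n : ℕ, ∀ᵐ ω ∂P, {i | t i ω ∈ Ico (-(n : ℝ)) 0 ∧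
      ((x i ω +ᵥ (X i ω : Set Plane)) ∩ Metric.ball 0 n).Nonempty}.Finite := by
    intro n
    have hC : MeasurableSet {q : (Plane × ℝ) × Closeds Plane | q.1.2 ∈ Ico (-(n : ℝ)) 0 ∧
        ((q.1.1 +ᵥ (q.2 : Set Plane)) ∩ Metric.ball 0 n).Nonempty} :=
      (measurableSet_Ico.preimage (f := fun q : (Plane × ℝ) × Closeds Plane => q.1.2)
        (by fun_prop)).inter ((measurableSet_vadd_hit Metric.isOpen_ball).preimage
          (f := fun q : (Plane × ℝ) × Closeds Plane => (q.1.1, q.2)) (by fun_prop))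
    refine hxt.ae_finite_marked hX hXlaw (fun i => hindep.comp
      (φ := fun p : ℕ → Plane × ℝ => p i) (ψ := fun F : ℕ → Closeds Plane => F i)
      (measurable_pi_apply i) (measurable_pi_apply i)) hC ?_
    rw [Measure.prod_apply_symm hC,
      lintegral_map (measurable_measure_prodMk_right hC) hX₀m]
    -- The bound need not be measurable in `ω`; monotonicity of the integral does not require it.
    have hle : ∀ ω, volume ((fun a : Plane × ℝ => (a, X₀ ω)) ⁻¹'
        {q : (Plane × ℝ) × Closeds Plane | q.1.2 ∈ Ico (-(n : ℝ)) 0 ∧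
          ((q.1.1 +ᵥ (q.2 : Set Plane)) ∩ Metric.ball 0 n).Nonempty}) ≤
        volume ((X₀ ω : Set Plane) + Metric.closedBall (0 : Plane) n) * (n : ℝ≥0∞) := by
      intro ω
      have hset : (fun a : Plane × ℝ => (a, X₀ ω)) ⁻¹'
          {q : (Plane × ℝ) × Closeds Plane | q.1.2 ∈ Ico (-(n : ℝ)) 0 ∧
            ((q.1.1 +ᵥ (q.2 : Set Plane)) ∩ Metric.ball 0 n).Nonempty} =
          {a | ((a +ᵥ (X₀ ω : Set Plane)) ∩ Metric.ball 0 n).Nonempty} ×ˢ Ico (-(n : ℝ)) 0 := by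
        ext a
        exact and_comm
      rw [hset, Measure.volume_eq_prod, Measure.prod_prod, Real.volume_Ico]
      exact mul_le_mul' (measure_vadd_hit_ball_le _ _) (by simp)
    refine ((lintegral_mono hle).trans_lt ?_).ne
    rw [lintegral_mul_const' _ _ (ENNReal.natCast_ne_top n)]
    exact ENNReal.mul_lt_top (hC1 _ (isCompact_closedBall 0 _)) (ENNReal.natCast_lt_top n)
  have hcov : ∀ n, ∀ᵐ ω ∂P, ∃ i, t i ω < 0 ∧
      Metric.ball (denseSeq Plane n) r ⊆ x i ω +ᵥ (X i ω : Set Plane) := by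
    intro n
    have hH := measurableSet_subset_vadd
      (Metric.isOpen_ball (x := denseSeq Plane n) (ε := r))
    refine IsPoissonPointProcess.ae_exists_marked (ρ := (volume : Measure Plane)) hxt hX hXlaw
      hXindep hindep hH ?_
    rw [Measure.prod_apply_symm hH, lintegral_map (measurable_measure_prodMk_right hH) hX₀m]
    exact (hC2.trans_le (lintegral_mono fun ω => volume_erosion_le _ c (denseSeq Plane n) r)).ne'
  filter_upwards [hinj, ae_all_iff.2 hfin, ae_all_iff.2 hcov] with ω h1 h2 h3
  exact isTessellation_visiblePart hr h1 h2 h3
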